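/- Let $d\ge 1$ and let $k_1,\dots,k_d,l_1,\dots,l_d$ be positive even integers with $$\min_{1\le i\le d}\,(l_ik_i-1)>\max_{1\le i\le d}\,\max(l_i,k_i).$$ Let $\{x_{-2,\mathbf m}\}_{\mathbf m\in\mathbb Z^d}$, $\{x_{-1,\mathbf m}\}_{\mathbf m\in\mathbb Z^d}$, $a_1,\dots,a_d$ and $b_1,\dots,b_d$ be algebraically independent indeterminates over $\mathbb Q$, and let $\mathbf e_1,\dots,\mathbf e_d$ be the standard unit vectors of $\mathbb Z^d$. Define $x_{t,\mathbf n}$, for $t\ge -2$ and $\mathbf n\in\mathbb Z^d$, as elements of the field $K=\mathbb Q(\{x_{-2,\mathbf m},x_{-1,\mathbf m}\}_{\mathbf m\in\mathbb Z^d},\{a_i,b_i\}_{1\le i\le d})$ by these initial variables and $$x_{t+1,\mathbf n}+x_{t-1,\mathbf n}=\sum_{i=1}^d\left(\frac{a_i}{x_{t,\mathbf n+\mathbf e_i}^{k_i}}+\frac{b_i}{x_{t,\mathbf n-\mathbf e_i}^{l_i}}\right)\qquad(t\ge -1).$$ Then every $x_{t,\mathbf n}$ with $t\ge -2$ is nonzero,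 so that the evolution is well defined. Moreover, if $t,t'\ge -2$ and $\mathbf n,\mathbf n'\in\mathbb Z^d$ satisfy $$|t-t'|+\sum_{i=1}^d|n_i-n_i'|>2,$$ then $x_{t,\mathbf n}$ and $x_{t',\mathbf n'}$ are coprime in $K$. That is, when both are written in lowest terms as quotients of polynomials in $\mathbb Q[\{x_{-2,\mathbf m},x_{-1,\mathbf m}\},\{a_i,b_i\}]$, neither the numerator nor the denominator of the one has a nonconstant common factor with the numerator or the denominator of the other. -/

import Mathlib

noncomputable section

namespace LatticeKdV

/-- The indeterminates: the initial variables `x_{-2,m}` and `x_{-1,m}`, for `m ∈ ℤ^d`, and the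
parameters `a_i` and `b_i`, for `1 ≤ i ≤ d`. -/
inductive Var (d : ℕ) : Type
  | xm2 (m : Fin d → ℤ) : Var d
  | xm1 (m : Fin d → ℤ) : Var d
  | a (i : Fin d) : Var d
  | b (i : Fin d) : Var d

/-- The polynomial ring `ℚ[{x_{-2,m}, x_{-1,m}}, {a_i, b_i}]`, a unique factorization domain. -/
abbrev Poly (d : ℕ) : Type := MvPolynomial (Var d) ℚ

/-- The field of rational functions `ℚ({x_{-2,m}, x_{-1,m}}, {a_i, b_i})`. -/
abbrev RatFun (d : ℕ) : Type := FractionRing (Poly d)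

/-- An indeterminate, as an element of the field of rational functions. -/
def var {d : ℕ} (v : Var d) : RatFun d := algebraMap (Poly d) (RatFun d) (MvPolynomial.X v)

/-- The unit vector `e_i` of `ℤ^d`. -/
def e {d : ℕ} (i : Fin d) : Fin d → ℤ := Pi.single i 1

/-- The evolution with time shifted by two: `xAux k l s n` is `x_{s-2,n}`. -/
def xAux {d : ℕ} (k l : Fin d → ℕ) : ℕ → (Fin d → ℤ) → RatFun d
  | 0, n => var (Var.xm2 n)
  | 1, n => var (Var.xm1 n)
  | s + 2, n =>
      ∑ i, (var (Var.a i) / xAux k l (s + 1) (n + e i) ^ k i +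
        var (Var.b i) / xAux k l (s + 1) (n - e i) ^ l i) - xAux k l s n

/-- The iterate `x_{t,n}`, for `t ≥ -2`, as a rational function of the initial variables and the
parameters. (Values at `t < -2` carry no meaning.) -/
def x {d : ℕ} (k l : Fin d → ℕ) (t : ℤ) (n : Fin d → ℤ) : RatFun d := xAux k l (t + 2).toNat n

theorem x_neg_two {d : ℕ} (k l : Fin d → ℕ) (n : Fin d → ℤ) :
    x k l (-2) n = var (Var.xm2 n) := rfl

theorem x_neg_one {d : ℕ} (k l : Fin d → ℕ) (n : Fin d → ℤ) :
    x k l (-1) n = var (Var.xm1 n) := rfl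

/-- The iterates satisfy the nonlinear equation for all `t ≥ -1`. -/
theorem x_equation {d : ℕ} (k l : Fin d → ℕ) (t : ℤ) (ht : -1 ≤ t) (n : Fin d → ℤ) :
    x k l (t + 1) n + x k l (t - 1) n =
      ∑ i, (var (Var.a i) / x k l t (n + e i) ^ k i +
        var (Var.b i) / x k l t (n - e i) ^ l i) := by
  obtain ⟨s, rfl⟩ : ∃ s : ℕ, t = (s : ℤ) - 1 := ⟨(t + 1).toNat, by omega⟩
  have h0 : ((s : ℤ) - 1 - 1 + 2).toNat = s := by omega
  have h1 : ((s : ℤ) - 1 + 2).toNat = s + 1 := by omega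
  have h2 : ((s : ℤ) - 1 + 1 + 2).toNat = s + 2 := by omega
  simp only [x, h0, h1, h2]
  rw [xAux, sub_add_cancel]

/-- Two rational functions are coprime if, when both are written in lowest terms, neither the
numerator nor the denominator of the one has a nonconstant common factor with the numerator or
with the denominator of the other. -/
def RatCoprime {d : ℕ} (f g : RatFun d) : Prop :=
  IsRelPrime (IsFractionRing.num (Poly d) f) (IsFractionRing.num (Poly d) g) ∧
  IsRelPrime (IsFractionRing.num (Poly d) f) (IsFractionRing.den (Poly d) g : Poly d) ∧
  IsRelPrime (IsFractionRing.den (Poly d) f : Poly d) (IsFractionRing.num (Poly d) g) ∧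
  IsRelPrime (IsFractionRing.den (Poly d) f : Poly d) (IsFractionRing.den (Poly d) g : Poly d)

end LatticeKdV

end

/-! Write `s = t + 2`, so that layers 0 and 1 carry the initial variables. Coprimality is tested one
prime `p` of the polynomial ring at a time: it suffices that any two sites at which the iterate is
not a unit at `p` are at ℓ¹ distance at most 2 in space-time.

For `p = x_{-1,n}` this is singularity confinement. The zero at `(1, n)` produces poles of order
`k_i` or `l_i` at the neighbours of `n` in layer 2. Each pole is seen from `(3, n)` through the
complementary exponent, so the value there is `-x_{-1,n}` up to terms of order `k_i l_i`. The
exponents are even and `k_i l_i` is large, so the poles this zero would create in layer 4 cancel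
against those of layer 2, and nothing singular remains (`varValuation_xAux_four_le_one`,
`varValuation_xAux_xm1`).

Absence of poles does not yet exclude new zeros. These are ruled out by differentiating with respect
to a variable `x_{-1,M}` on the edge of the domain of dependence: only one straight path
contributes, and the derivative is a product of units along it. If `M ≠ n`, differentiation
preserves divisibility by `x_{-1,n}`, so the iterate is not divisible
(`varValuation_xAux_eq_one_of_path`). The same argument at `p = x_{-2,n}` shows that all later
iterates are units there, hence nonzero.

For a general `p`, let `t + 1 ≥ 1` be the first layer with a non-unit, at a site `n`. The evolution
is reversible and extends to an endomorphism of the field (`stepHom`). Pulled back along `t` steps,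
the valuation at `p` is centred at the prime `x_{-1,n}` (`primeValuation_evolve_eq_one`). The
non-units at `p` thus lie in the confined pattern translated by `t`, which is contained in the unit
ball around `(t + 2, n)`. -/

noncomputable section

/-! ### Valuations at primes of a unique factorization domain -/

section PrimeValuation

variable {R : Type*} (K : Type*) [CommRing R] [IsDomain R] [UniqueFactorizationMonoid R] [Field K]
  [Algebra R K] [IsFractionRing R K]

/-- The localization of a unique factorization domain at a prime element, as a valuation subring of
the field of fractions. -/
def primeValuationSubring {p : R} (hp : Prime p) : ValuationSubring K where
  carrier := {y | ∃ f g : R, ¬ p ∣ g ∧ y = algebraMap R K f / algebraMap R K g}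
  mul_mem' := by
    rintro _ _ ⟨f, g, hg, rfl⟩ ⟨f', g', hg', rfl⟩
    refine ⟨f * f', g * g', hp.not_dvd_mul hg hg', ?_⟩
    rw [map_mul, map_mul, div_mul_div_comm]
  one_mem' := ⟨1, 1, hp.not_dvd_one, by simp⟩
  add_mem' := by
    rintro _ _ ⟨f, g, hg, rfl⟩ ⟨f', g', hg', rfl⟩
    have h : ∀ {r : R}, ¬ p ∣ r → algebraMap R K r ≠ 0 := fun hr h0 =>
      hr (by rw [(IsFractionRing.injective R K) (h0.trans (map_zero _).symm)]; exact dvd_zero p)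
    refine ⟨f * g' + g * f', g * g', hp.not_dvd_mul hg hg', ?_⟩
    rw [div_add_div _ _ (h hg) (h hg'), map_add, map_mul, map_mul, map_mul]
  zero_mem' := ⟨0, 1, hp.not_dvd_one, by simp⟩
  neg_mem' := by
    rintro _ ⟨f, g, hg, rfl⟩
    exact ⟨-f, g, hg, by rw [map_neg, neg_div]⟩
  mem_or_inv_mem' := by
    intro y
    by_cases hd : p ∣ (IsFractionRing.den R y : R)
    · right
      refine ⟨IsFractionRing.den R y, IsFractionRing.num R y, fun hn => ?_, ?_⟩
      · exact hp.not_isUnit (IsFractionRing.num_den_reduced R y hn hd)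
      · conv_lhs => rw [← IsFractionRing.mk'_num_den' R y]
        rw [inv_div]
    · left
      exact ⟨_, _, hd, (IsFractionRing.mk'_num_den' R y).symm⟩

theorem mem_primeValuationSubring {p : R} (hp : Prime p) {y : K} :
    y ∈ primeValuationSubring K hp ↔
      ∃ f g : R, ¬ p ∣ g ∧ y = algebraMap R K f / algebraMap R K g := Iff.rfl

/-- The valuation of the field of fractions attached to a prime element. -/
abbrev primeValuation {p : R} (hp : Prime p) :
    Valuation K (primeValuationSubring K hp).ValueGroup :=
  (primeValuationSubring K hp).valuation

variable {K}

theorem primeValuation_algebraMap_le_one {p : R} (hp : Prime p) (f : R) :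
    primeValuation K hp (algebraMap R K f) ≤ 1 :=
  (ValuationSubring.valuation_le_one_iff _ _).2
    ((mem_primeValuationSubring K hp).2 ⟨f, 1, hp.not_dvd_one, by simp⟩)

theorem primeValuation_algebraMap_eq_one_iff {p : R} (hp : Prime p) {f : R} :
    primeValuation K hp (algebraMap R K f) = 1 ↔ ¬ p ∣ f := by
  constructor
  · intro h hpf
    have h' : primeValuation K hp (algebraMap R K f)⁻¹ ≤ 1 := by rw [map_inv₀, h, inv_one]
    obtain ⟨r, s, hs, hrs⟩ := (mem_primeValuationSubring K hp).1
      ((ValuationSubring.valuation_le_one_iff _ _).1 h')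
    have hf : algebraMap R K f ≠ 0 := fun h0 => by rw [h0, map_zero] at h; exact zero_ne_one h
    have hs0 : algebraMap R K s ≠ 0 := fun h0 => hs (by
      rw [(IsFractionRing.injective R K) (h0.trans (map_zero _).symm)]; exact dvd_zero p)
    rw [inv_eq_one_div, div_eq_div_iff hf hs0, one_mul, ← map_mul] at hrs
    exact hs (by rw [IsFractionRing.injective R K hrs]; exact hpf.mul_left r)
  · intro h
    refine le_antisymm (primeValuation_algebraMap_le_one hp f) ?_
    have h' : primeValuation K hp (algebraMap R K f)⁻¹ ≤ 1 :=
      (ValuationSubring.valuation_le_one_iff _ _).2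
        ((mem_primeValuationSubring K hp).2 ⟨1, f, h, by simp⟩)
    have hf : algebraMap R K f ≠ 0 := fun h0 => h (by
      rw [(IsFractionRing.injective R K) (h0.trans (map_zero _).symm)]; exact dvd_zero p)
    rw [map_inv₀] at h'
    exact (inv_le_one₀ (zero_lt_iff.2 ((Valuation.ne_zero_iff _).2 hf))).1 h'

theorem primeValuation_algebraMap_lt_one_iff {p : R} (hp : Prime p) {f : R} :
    primeValuation K hp (algebraMap R K f) < 1 ↔ p ∣ f := by
  rw [lt_iff_le_and_ne, ne_eq, primeValuation_algebraMap_eq_one_iff, not_not]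
  exact ⟨fun h => h.2, fun h => ⟨primeValuation_algebraMap_le_one hp f, h⟩⟩

theorem exists_eq_div_of_primeValuation_le_one {p : R} (hp : Prime p) {y : K}
    (hy : primeValuation K hp y ≤ 1) :
    ∃ f g : R, ¬ p ∣ g ∧ y = algebraMap R K f / algebraMap R K g :=
  (mem_primeValuationSubring K hp).1 ((ValuationSubring.valuation_le_one_iff _ _).1 hy)

theorem exists_eq_div_of_primeValuation_lt_one {p : R} (hp : Prime p) {y : K}
    (hy : primeValuation K hp y < 1) :
    ∃ f g : R, p ∣ f ∧ ¬ p ∣ g ∧ y = algebraMap R K f / algebraMap R K g := by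
  obtain ⟨f, g, hg, rfl⟩ := exists_eq_div_of_primeValuation_le_one hp hy.le
  refine ⟨f, g, ?_, hg, rfl⟩
  rwa [map_div₀, (primeValuation_algebraMap_eq_one_iff hp).2 hg, div_one,
    primeValuation_algebraMap_lt_one_iff] at hy

theorem exists_eq_div_of_primeValuation_eq_one {p : R} (hp : Prime p) {y : K}
    (hy : primeValuation K hp y = 1) :
    ∃ f g : R, ¬ p ∣ f ∧ ¬ p ∣ g ∧ y = algebraMap R K f / algebraMap R K g := by
  obtain ⟨f, g, hg, rfl⟩ := exists_eq_div_of_primeValuation_le_one hp hy.le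
  refine ⟨f, g, ?_, hg, rfl⟩
  rwa [map_div₀, (primeValuation_algebraMap_eq_one_iff hp).2 hg, div_one,
    primeValuation_algebraMap_eq_one_iff] at hy

/-- Discreteness: every nonzero non-unit of the valuation ring has the valuation of a positive power
of the prime. -/
theorem exists_primeValuation_eq_pow {p : R} (hp : Prime p) {y : K} (hy0 : y ≠ 0)
    (hy : primeValuation K hp y < 1) :
    ∃ n : ℕ, n ≠ 0 ∧ primeValuation K hp y = primeValuation K hp (algebraMap R K p) ^ n := by
  obtain ⟨f, g, hf, hg, rfl⟩ := exists_eq_div_of_primeValuation_lt_one hp hy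
  have hf0 : f ≠ 0 := by rintro rfl; simp at hy0
  obtain ⟨n, f', hf', rfl⟩ := WfDvdMonoid.max_power_factor hf0 hp.irreducible
  refine ⟨n, ?_, ?_⟩
  · rintro rfl
    exact hf' (by simpa using hf)
  · rw [map_div₀, map_mul, map_mul, map_pow, map_pow,
      (primeValuation_algebraMap_eq_one_iff hp).2 hg,
      (primeValuation_algebraMap_eq_one_iff hp).2 hf', mul_one, div_one]

omit [IsDomain R] in
/-- Elements without a common prime factor are relatively prime. -/
theorem isRelPrime_of_forall_prime {a b : R} (ha : a ≠ 0)
    (h : ∀ p : R, Prime p → p ∣ a → ¬ p ∣ b) : IsRelPrime a b := by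
  intro c hca hcb
  by_contra hc
  obtain ⟨p, hp, hpc⟩ := WfDvdMonoid.exists_irreducible_factor hc (ne_zero_of_dvd_ne_zero ha hca)
  exact h p hp.prime (hpc.trans hca) (hpc.trans hcb)

theorem primeValuation_ne_one_of_dvd_num {p : R} (hp : Prime p) {y : K}
    (h : p ∣ IsFractionRing.num R y) : primeValuation K hp y ≠ 1 := by
  have hd : ¬ p ∣ (IsFractionRing.den R y : R) := fun hd =>
    hp.not_isUnit (IsFractionRing.num_den_reduced R y h hd)
  rw [← IsFractionRing.mk'_num_den' R y, map_div₀, (primeValuation_algebraMap_eq_one_iff hp).2 hd,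
    div_one, ne_eq, primeValuation_algebraMap_eq_one_iff, not_not]
  exact h

theorem primeValuation_ne_one_of_dvd_den {p : R} (hp : Prime p) {y : K}
    (h : p ∣ (IsFractionRing.den R y : R)) : primeValuation K hp y ≠ 1 := by
  have hn : ¬ p ∣ IsFractionRing.num R y := fun hn =>
    hp.not_isUnit (IsFractionRing.num_den_reduced R y hn h)
  rw [← IsFractionRing.mk'_num_den' R y, map_div₀, (primeValuation_algebraMap_eq_one_iff hp).2 hn,
    one_div, ne_eq, inv_eq_one, primeValuation_algebraMap_eq_one_iff, not_not]
  exact h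

end PrimeValuation

namespace LatticeKdV

/-- A prime dividing the numerator or the denominator of a reduced fraction makes the fraction a
non-unit, so one condition on valuations covers all four pairs. The hypothesis `f ≠ 0` ensures that
a nontrivial common factor has a prime divisor. -/
theorem ratCoprime_of_forall_prime {d : ℕ} {f g : RatFun d} (hf : f ≠ 0)
    (h : ∀ (p : Poly d) (hp : Prime p), primeValuation (RatFun d) hp f ≠ 1 →
      primeValuation (RatFun d) hp g = 1) : RatCoprime f g := by
  have hn : IsFractionRing.num (Poly d) f ≠ 0 := (IsFractionRing.num_eq_zero f).not.2 hf
  have hd : (IsFractionRing.den (Poly d) f : Poly d) ≠ 0 := nonZeroDivisors.coe_ne_zero _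
  refine ⟨isRelPrime_of_forall_prime hn ?_, isRelPrime_of_forall_prime hn ?_,
    isRelPrime_of_forall_prime hd ?_, isRelPrime_of_forall_prime hd ?_⟩ <;> intro p hp h1 h2
  · exact primeValuation_ne_one_of_dvd_num hp h2 (h p hp (primeValuation_ne_one_of_dvd_num hp h1))
  · exact primeValuation_ne_one_of_dvd_den hp h2 (h p hp (primeValuation_ne_one_of_dvd_num hp h1))
  · exact primeValuation_ne_one_of_dvd_num hp h2 (h p hp (primeValuation_ne_one_of_dvd_den hp h1))
  · exact primeValuation_ne_one_of_dvd_den hp h2 (h p hp (primeValuation_ne_one_of_dvd_den hp h1))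

end LatticeKdV

/-! ### Partial derivatives of rational functions, by way of dual numbers -/

section PartialDerivative

open MvPolynomial

variable {σ k : Type*} (K : Type*) [Field k] [Field K] [Algebra (MvPolynomial σ k) K]
  [IsFractionRing (MvPolynomial σ k) K]

open Classical in
/-- First order expansion in the direction of the indeterminate `u`. -/
def firstOrder (u : σ) : MvPolynomial σ k →+* TrivSqZeroExt K K :=
  eval₂Hom
    ((TrivSqZeroExt.inlHom K K).comp ((algebraMap (MvPolynomial σ k) K).comp C))
    fun w => TrivSqZeroExt.inl (algebraMap (MvPolynomial σ k) K (X w)) +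
      TrivSqZeroExt.inr (if w = u then 1 else 0)

omit [IsFractionRing (MvPolynomial σ k) K] in
theorem firstOrder_eq (u : σ) (f : MvPolynomial σ k) :
    firstOrder K u f = TrivSqZeroExt.inl (algebraMap (MvPolynomial σ k) K f) +
      TrivSqZeroExt.inr (algebraMap (MvPolynomial σ k) K (pderiv u f)) := by
  classical
  induction f using MvPolynomial.induction_on with
  | C q => simp [firstOrder]
  | add f g hf hg =>
    rw [map_add, hf, hg, map_add, map_add, map_add, TrivSqZeroExt.inl_add, TrivSqZeroExt.inr_add]
    abel
  | mul_X f w hf =>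
    rw [map_mul, hf, firstOrder, eval₂Hom_X']
    ext
    · simp only [TrivSqZeroExt.fst_mul, TrivSqZeroExt.fst_add, TrivSqZeroExt.fst_inl,
        TrivSqZeroExt.fst_inr, map_mul, add_zero]
    · simp only [TrivSqZeroExt.snd_mul, TrivSqZeroExt.snd_add, TrivSqZeroExt.snd_inl,
        TrivSqZeroExt.snd_inr, TrivSqZeroExt.fst_add, TrivSqZeroExt.fst_inl,
        TrivSqZeroExt.fst_inr, map_mul, add_zero, zero_add, smul_eq_mul, Derivation.leibniz,
        pderiv_X, Pi.single_apply, map_add, MulOpposite.smul_eq_mul_unop, MulOpposite.unop_op]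
      split_ifs <;> simp [mul_comm]

theorem isUnit_firstOrder (u : σ) (f : nonZeroDivisors (MvPolynomial σ k)) :
    IsUnit (firstOrder K u (f : MvPolynomial σ k)) := by
  rw [TrivSqZeroExt.isUnit_iff_isUnit_fst, firstOrder_eq, isUnit_iff_ne_zero]
  simp

/-- First order expansion of rational functions in the direction of the indeterminate `u`. -/
def firstOrderFrac (u : σ) : K →+* TrivSqZeroExt K K :=
  IsLocalization.lift (M := nonZeroDivisors (MvPolynomial σ k)) (isUnit_firstOrder K u)

theorem firstOrderFrac_algebraMap (u : σ) (f : MvPolynomial σ k) :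
    firstOrderFrac (k := k) K u (algebraMap (MvPolynomial σ k) K f) = firstOrder K u f :=
  IsLocalization.lift_eq _ _

theorem fst_firstOrderFrac (u : σ) (y : K) : (firstOrderFrac (k := k) K u y).fst = y := by
  have h : ((TrivSqZeroExt.fstHom K K K).toRingHom.comp (firstOrderFrac (k := k) K u)) =
      RingHom.id _ := by
    refine IsLocalization.ringHom_ext (nonZeroDivisors (MvPolynomial σ k))
      (RingHom.ext fun f => ?_)
    simp [firstOrderFrac_algebraMap, firstOrder_eq]
  exact DFunLike.congr_fun h y

variable (k)

/-- The partial derivative of rational functions with respect to the indeterminate `u`. -/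
def ratDeriv (u : σ) : Derivation ℤ K K :=
  Derivation.mk' ((TrivSqZeroExt.sndHom K K).toAddMonoidHom.comp
    (firstOrderFrac (k := k) K u).toAddMonoidHom).toIntLinearMap fun y z => by
      simp [fst_firstOrderFrac, mul_comm z]

variable {K}

theorem ratDeriv_algebraMap (u : σ) (f : MvPolynomial σ k) :
    ratDeriv k K u (algebraMap (MvPolynomial σ k) K f) =
      algebraMap (MvPolynomial σ k) K (pderiv u f) := by
  change (firstOrderFrac K u _).snd = _
  rw [firstOrderFrac_algebraMap, firstOrder_eq, TrivSqZeroExt.snd_add, TrivSqZeroExt.snd_inl,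
    TrivSqZeroExt.snd_inr, zero_add]

theorem ratDeriv_X_self (u : σ) :
    ratDeriv k K u (algebraMap (MvPolynomial σ k) K (X u)) = 1 := by
  simp [ratDeriv_algebraMap]

theorem ratDeriv_X_of_ne {u w : σ} (h : w ≠ u) :
    ratDeriv k K u (algebraMap (MvPolynomial σ k) K (X w)) = 0 := by
  simp [ratDeriv_algebraMap, pderiv_X_of_ne h]

theorem ratDeriv_div_pow {u : σ} {a : K} (ha : ratDeriv k K u a = 0) (y : K) (n : ℕ) :
    ratDeriv k K u (a / y ^ n) =
      -(a * (y ^ n)⁻¹ ^ 2 * (n * y ^ (n - 1) * ratDeriv k K u y)) := by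
  rw [Derivation.leibniz_div, ha, Derivation.leibniz_pow]
  simp only [smul_eq_mul, nsmul_eq_mul]
  ring

/-- Partial derivatives with respect to other indeterminates preserve divisibility by an
indeterminate. -/
theorem primeValuation_ratDeriv_lt_one {u w : σ} (h : w ≠ u)
    (hw : Prime (X w : MvPolynomial σ k)) {y : K} (hy : primeValuation K hw y < 1) :
    primeValuation K hw (ratDeriv k K u y) < 1 := by
  obtain ⟨f, g, ⟨f', rfl⟩, hg, rfl⟩ := exists_eq_div_of_primeValuation_lt_one hw hy
  have hgv := (primeValuation_algebraMap_eq_one_iff (K := K) hw).2 hg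
  rw [Derivation.leibniz_div, smul_eq_mul, map_mul, map_pow, map_inv₀, hgv, inv_one, one_pow,
    one_mul, ratDeriv_algebraMap, ratDeriv_algebraMap, smul_eq_mul, smul_eq_mul, ← map_mul,
    ← map_mul, ← map_sub, primeValuation_algebraMap_lt_one_iff]
  rw [Derivation.leibniz, pderiv_X_of_ne h, smul_zero, add_zero, smul_eq_mul]
  exact ⟨g * pderiv u f' - f' * pderiv u g, by ring⟩

end PartialDerivative

/-! ### Cancellation of poles -/

section Confinement

variable {K Γ₀ : Type*} [Field K] [LinearOrderedCommGroupWithZero Γ₀] (v : Valuation K Γ₀)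

theorem Valuation.map_one_sub_pow_sub_one_le {η : K} (hη : v η < 1) (n : ℕ) :
    v ((1 - η) ^ n - 1) ≤ v η := by
  induction n with
  | zero => simp
  | succ n ih =>
    have h : (1 - η) ^ (n + 1) - 1 = (1 - η) * ((1 - η) ^ n - 1) - η := by ring
    rw [h]
    refine v.map_sub_le ?_ le_rfl
    rw [map_mul, v.map_one_sub_of_lt hη, one_mul]
    exact ih

/-- The poles of `A / ε ^ n` and of `A / (h - ε) ^ n` cancel if `n` is even and `h` vanishes to a
sufficiently high order. -/
theorem Valuation.map_div_pow_sub_div_pow_le_one {A ε h : K} {n : ℕ} (hA : v A = 1) (hn : Even n)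
    (hε0 : ε ≠ 0) (hε : v ε < 1) (hn0 : n ≠ 0) (hh : v h ≤ v ε ^ (n + 1)) :
    v (A / (h - ε) ^ n - A / ε ^ n) ≤ 1 := by
  have hv0 : v ε ≠ 0 := v.ne_zero_iff.2 hε0
  set η := h / ε with hηdef
  have hη : v η ≤ v ε ^ n := by
    rw [hηdef, map_div₀, div_le_iff₀ (zero_lt_iff.2 hv0), ← pow_succ]
    exact hh
  have hη1 : v η < 1 := hη.trans_lt (pow_lt_one₀ zero_le hε hn0)
  have h1 : v (1 - η) = 1 := v.map_one_sub_of_lt hη1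
  have h10 : (1 - η) ≠ 0 := fun h0 => by rw [h0, map_zero] at h1; exact zero_ne_one h1
  have hhe : h - ε = -(ε * (1 - η)) := by rw [hηdef]; field_simp; ring
  -- Evenness of `n` removes the sign in `h - ε = -ε (1 - η)`. The numerator then contains `(1 - η)
  -- ^ n - 1`, whose valuation is at most that of `η`, hence at most `v ε ^ n`; this compensates the
  -- pole `ε ^ n`.
  have key : A / (h - ε) ^ n - A / ε ^ n =
      -(A * ((1 - η) ^ n - 1) / (ε ^ n * (1 - η) ^ n)) := by
    rw [hhe, hn.neg_pow, mul_pow]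
    have h2 : ε ^ n ≠ 0 := pow_ne_zero _ hε0
    have h3 : (1 - η) ^ n ≠ 0 := pow_ne_zero _ h10
    rw [div_sub_div _ _ (mul_ne_zero h2 h3) h2, ← neg_div,
      div_eq_div_iff (mul_ne_zero (mul_ne_zero h2 h3) h2) (mul_ne_zero h2 h3)]
    ring
  rw [key, Valuation.map_neg, map_div₀, map_mul, map_mul, map_pow, map_pow, h1, hA, one_mul,
    one_pow, mul_one, div_le_iff₀ (zero_lt_iff.2 (pow_ne_zero _ hv0)), one_mul]
  exact (v.map_one_sub_pow_sub_one_le hη1 n).trans hη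

end Confinement

/-! ### Directions on the lattice and valuations at the indeterminates -/

namespace LatticeKdV

variable {d : ℕ}

/-- The displacement in the direction `c`, which is `e_i` or `-e_i`. -/
def shift (c : Fin d × Bool) : Fin d → ℤ := if c.2 then e c.1 else -e c.1

/-- The parameter attached to the direction `c`, which is `a_i` or `b_i`. -/
def coef (c : Fin d × Bool) : Var d := if c.2 then Var.a c.1 else Var.b c.1

/-- The exponent attached to the direction `c`, which is `k_i` or `l_i`. -/
def expo (k l : Fin d → ℕ) (c : Fin d × Bool) : ℕ := if c.2 then k c.1 else l c.1

/-- The opposite direction. -/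
def opp (c : Fin d × Bool) : Fin d × Bool := (c.1, !c.2)

theorem shift_opp (c : Fin d × Bool) : shift (opp c) = -shift c := by
  rcases c with ⟨i, _ | _⟩ <;> simp [shift, opp]

theorem xAux_add_two (k l : Fin d → ℕ) (s : ℕ) (n : Fin d → ℤ) :
    xAux k l (s + 2) n =
      ∑ c, var (coef c) / xAux k l (s + 1) (n + shift c) ^ expo k l c - xAux k l s n := by
  rw [xAux, Fintype.sum_prod_type]
  simp only [Fintype.sum_bool, coef, shift, expo, if_true, Bool.false_eq_true, if_false,
    ← sub_eq_add_neg]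

/-- The coordinate of a lattice point along the direction `c`. -/
def coord (c : Fin d × Bool) (m : Fin d → ℤ) : ℤ := if c.2 then m c.1 else -m c.1

theorem coord_add (c : Fin d × Bool) (m m' : Fin d → ℤ) :
    coord c (m + m') = coord c m + coord c m' := by
  simp only [coord, Pi.add_apply]; split_ifs <;> ring

theorem coord_nsmul (c : Fin d × Bool) (j : ℕ) (m : Fin d → ℤ) :
    coord c (j • m) = j * coord c m := by
  simp only [coord, Pi.smul_apply, nsmul_eq_mul]; split_ifs <;> ring

theorem coord_shift_self (c : Fin d × Bool) : coord c (shift c) = 1 := by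
  rcases c with ⟨i, _ | _⟩ <;> simp [coord, shift, e]

theorem coord_shift_of_ne {c c' : Fin d × Bool} (h : c' ≠ c) : coord c (shift c') ≤ 0 := by
  rcases c with ⟨i, _ | _⟩ <;> rcases c' with ⟨i', _ | _⟩ <;>
    by_cases hi : i = i' <;> simp_all [coord, shift, e]

theorem coord_shift_le_one (c c' : Fin d × Bool) : coord c (shift c') ≤ 1 := by
  by_cases h : c' = c
  · rw [h, coord_shift_self]
  · exact (coord_shift_of_ne h).trans zero_le_one

theorem eq_of_shift_eq {c c' : Fin d × Bool} (h : shift c = shift c') : c = c' := by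
  by_contra hc
  have h1 := coord_shift_of_ne hc
  rw [h, coord_shift_self] at h1
  omega

/-- The valuation of the field of rational functions attached to an indeterminate. -/
abbrev varValuation (w : Var d) :=
  primeValuation (RatFun d) (MvPolynomial.X_prime (R := ℚ) (i := w))

theorem varValuation_var_of_ne {w u : Var d} (h : w ≠ u) : varValuation w (var u) = 1 := by
  rw [varValuation, var, primeValuation_algebraMap_eq_one_iff, MvPolynomial.X_dvd_X]
  exact h

theorem varValuation_var_self (w : Var d) : varValuation w (var w) < 1 := by
  rw [varValuation, var, primeValuation_algebraMap_lt_one_iff]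

theorem var_ne_zero (w : Var d) : var w ≠ 0 := by
  rw [var, ne_eq, FaithfulSMul.algebraMap_eq_zero_iff]
  exact MvPolynomial.X_ne_zero w

theorem varValuation_natCast (w : Var d) {n : ℕ} (hn : n ≠ 0) :
    varValuation w (n : RatFun d) = 1 := by
  rw [← map_natCast (algebraMap (Poly d) (RatFun d)), varValuation,
    primeValuation_algebraMap_eq_one_iff]
  have hu : IsUnit (n : Poly d) := by
    rw [← map_natCast (MvPolynomial.C (R := ℚ) (σ := Var d))]
    exact (isUnit_iff_ne_zero.2 (Nat.cast_ne_zero.2 hn)).map _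
  exact fun h => MvPolynomial.X_prime.not_isUnit (isUnit_of_dvd_unit h hu)

/-- The partial derivative of rational functions with respect to the indeterminate `u`. -/
abbrev partialDeriv (u : Var d) := ratDeriv ℚ (RatFun d) u

theorem partialDeriv_var_self (u : Var d) : partialDeriv u (var u) = 1 := ratDeriv_X_self ℚ u

theorem partialDeriv_var_of_ne {u w : Var d} (h : w ≠ u) : partialDeriv u (var w) = 0 :=
  ratDeriv_X_of_ne ℚ h

theorem coef_ne_xm1 (c : Fin d × Bool) (m : Fin d → ℤ) : coef c ≠ Var.xm1 m := by
  rw [coef]; split_ifs <;> simp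

theorem coef_ne_xm2 (c : Fin d × Bool) (m : Fin d → ℤ) : coef c ≠ Var.xm2 m := by
  rw [coef]; split_ifs <;> simp

/-! ### Derivatives on the edge of the domain of dependence -/

theorem partialDeriv_div_pow {u w : Var d} (h : w ≠ u) (y : RatFun d) (n : ℕ) :
    partialDeriv u (var w / y ^ n) =
      -(var w * (y ^ n)⁻¹ ^ 2 * (n * y ^ (n - 1) * partialDeriv u y)) :=
  ratDeriv_div_pow ℚ (partialDeriv_var_of_ne h) y n

/-- Finite speed of propagation. -/
theorem partialDeriv_xAux_eq_zero (k l : Fin d → ℕ) (c : Fin d × Bool) (M : Fin d → ℤ) (s : ℕ) :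
    ∀ m, coord c m + s < coord c M + 1 → partialDeriv (Var.xm1 M) (xAux k l s m) = 0 := by
  induction s using Nat.strong_induction_on with
  | _ s ih =>
    intro m hm
    match s, ih, hm with
    | 0, _, _ => exact partialDeriv_var_of_ne (by simp)
    | 1, _, hm =>
      refine partialDeriv_var_of_ne ?_
      rintro h
      rw [Var.xm1.inj h] at hm
      push_cast at hm
      omega
    | s + 2, ih, hm =>
      push_cast at hm
      rw [xAux_add_two, map_sub, map_sum, ih s (by omega) m (by omega), sub_zero]
      refine Finset.sum_eq_zero fun c' _ => ?_
      have h1 := coord_shift_le_one c c'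
      rw [partialDeriv_div_pow (coef_ne_xm1 c' M), ih (s + 1) (by omega) (m + shift c')
        (by rw [coord_add]; push_cast; omega)]
      simp

/-- Only the neighbour in the direction `c` advances towards the edge. By finite speed of
propagation all other neighbours, and the layer two below, do not depend on `x_{-1,M}`. -/
theorem partialDeriv_xAux_add_two (k l : Fin d → ℕ) (c : Fin d × Bool) {M : Fin d → ℤ} {s : ℕ}
    {m : Fin d → ℤ} (h : coord c m + s + 1 = coord c M) :
    partialDeriv (Var.xm1 M) (xAux k l (s + 2) m) =
      partialDeriv (Var.xm1 M)
        (var (coef c) / xAux k l (s + 1) (m + shift c) ^ expo k l c) := by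
  rw [xAux_add_two, map_sub, map_sum, partialDeriv_xAux_eq_zero k l c M s m (by omega), sub_zero]
  refine Finset.sum_eq_single_of_mem c (Finset.mem_univ c) fun c' _ hc' => ?_
  have h1 := coord_shift_of_ne hc'
  rw [partialDeriv_div_pow (coef_ne_xm1 c' M), partialDeriv_xAux_eq_zero k l c M (s + 1) _
    (by rw [coord_add]; push_cast; omega)]
  simp

/-- The derivative of an iterate with respect to an initial variable on the edge of its domain of
dependence. -/
theorem varValuation_partialDeriv_xAux {k l : Fin d → ℕ} {w : Var d}
    (hexp : ∀ c, expo k l c ≠ 0) (hw : ∀ c, w ≠ coef c) (c : Fin d × Bool) (s : ℕ) :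
    ∀ m, (∀ j, 1 ≤ j → j ≤ s → varValuation w (xAux k l (s + 1 - j) (m + j • shift c)) = 1) →
      varValuation w (partialDeriv (Var.xm1 (m + s • shift c)) (xAux k l (s + 1) m)) = 1 := by
  induction s with
  | zero =>
    intro m _
    have h : xAux k l (0 + 1) m = var (Var.xm1 (m + 0 • shift c)) := by simp [xAux]
    rw [h, partialDeriv_var_self, map_one]
  | succ s ih =>
    intro m hm
    have h1 : varValuation w (xAux k l (s + 1) (m + shift c)) = 1 := by
      simpa using hm 1 le_rfl (by omega)
    have h2 := ih (m + shift c) fun j hj1 hj2 => by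
      have h := hm (j + 1) (by omega) (by omega)
      rwa [add_smul, one_smul, add_comm (j • shift c), ← add_assoc,
        show s + 1 + 1 - (j + 1) = s + 1 - j by omega] at h
    have h3 : m + (s + 1) • shift c = m + shift c + s • shift c := by
      rw [add_smul, one_smul, add_comm (s • shift c), ← add_assoc]
    rw [h3, partialDeriv_xAux_add_two k l c, partialDeriv_div_pow (coef_ne_xm1 c _),
      Valuation.map_neg]
    · simp only [map_mul, map_pow, map_inv₀, h1, h2, varValuation_var_of_ne (hw c),
        varValuation_natCast w (hexp c), one_pow, inv_one, mul_one]
    · simp only [coord_add, coord_nsmul, coord_shift_self]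
      ring

/-- If the iterate were divisible by `w`, so would be its derivative with respect to `x_{-1, m + s •
shift c}`, a variable different from `w`. But the chain rule along the path makes this derivative a
unit; the integer exponents that it brings down are units because the coefficients are rational. -/
theorem varValuation_xAux_eq_one_of_path {k l : Fin d → ℕ} {w : Var d}
    (hexp : ∀ c, expo k l c ≠ 0) (hw : ∀ c, w ≠ coef c) (c : Fin d × Bool) {s : ℕ}
    {m : Fin d → ℤ}
    (hpath : ∀ j, 1 ≤ j → j ≤ s → varValuation w (xAux k l (s + 1 - j) (m + j • shift c)) = 1)
    (hne : w ≠ Var.xm1 (m + s • shift c)) (hint : varValuation w (xAux k l (s + 1) m) ≤ 1) :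
    varValuation w (xAux k l (s + 1) m) = 1 := by
  refine le_antisymm hint (not_lt.1 fun hlt => ?_)
  exact (primeValuation_ratDeriv_lt_one ℚ hne _ hlt).ne
    (varValuation_partialDeriv_xAux hexp hw c s m hpath)

/-- Only zeros of the preceding layer can create poles. Its own poles are harmless, since its values
occur only in denominators. -/
theorem map_xAux_add_two_le_one {Γ₀ : Type*} [LinearOrderedCommGroupWithZero Γ₀]
    (v : Valuation (RatFun d) Γ₀) {k l : Fin d → ℕ} {s : ℕ} {m : Fin d → ℤ}
    (hc : ∀ c : Fin d × Bool, v (var (coef c)) ≤ 1)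
    (h1 : ∀ c, 1 ≤ v (xAux k l (s + 1) (m + shift c))) (h0 : v (xAux k l s m) ≤ 1) :
    v (xAux k l (s + 2) m) ≤ 1 := by
  rw [xAux_add_two]
  refine v.map_sub_le (v.map_sum_le fun c _ => ?_) h0
  rw [map_div₀, map_pow]
  exact div_le_one_of_le₀ ((hc c).trans (one_le_pow₀ (h1 c))) zero_le

/-- Layer 1 consists of units, so no pole ever arises. Every path ends at some `x_{-1,M}`, which
differs from `x_{-2,n}`, so any direction serves to exclude zeros; `0 < d` provides one. -/
theorem varValuation_xAux_xm2 {k l : Fin d → ℕ} (hd : 0 < d) (hexp : ∀ c, expo k l c ≠ 0)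
    (n : Fin d → ℤ) (s : ℕ) :
    ∀ m, varValuation (Var.xm2 n) (xAux k l (s + 1) m) = 1 := by
  have hw : ∀ c, Var.xm2 n ≠ coef c := fun c => (coef_ne_xm2 c n).symm
  induction s using Nat.strong_induction_on with
  | _ s ih =>
    intro m
    match s, ih with
    | 0, _ => exact varValuation_var_of_ne (by simp)
    | s + 1, ih =>
      refine varValuation_xAux_eq_one_of_path hexp hw (⟨0, hd⟩, true) (fun j hj1 hj2 => ?_)
        (by simp) ?_
      · rw [show s + 1 + 1 - j = (s + 1 - j) + 1 by omega]
        exact ih _ (by omega) _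
      · refine map_xAux_add_two_le_one _ (fun c => (varValuation_var_of_ne (hw c)).le)
          (fun c => (ih s (by omega) _).ge) ?_
        match s, ih with
        | 0, _ => exact primeValuation_algebraMap_le_one _ _
        | s + 1, ih => exact (ih s (by omega) _).le

theorem xAux_ne_zero {k l : Fin d → ℕ} (hd : 0 < d) (hexp : ∀ c, expo k l c ≠ 0) (s : ℕ)
    (m : Fin d → ℤ) : xAux k l s m ≠ 0 := by
  match s with
  | 0 => exact var_ne_zero _
  | s + 1 =>
    intro h
    have h1 := varValuation_xAux_xm2 hd hexp m s m
    rw [h, map_zero] at h1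
    exact zero_ne_one h1

/-! ### The singularity pattern of a zero at `x_{-1,n}` -/

/-- The sites at which a singularity created by a zero at time `1` and site `n` is visible. -/
def Singular (n : Fin d → ℤ) (s : ℕ) (m : Fin d → ℤ) : Prop :=
  s = 1 ∧ m = n ∨ (s = 2 ∧ ∃ c, m = n + shift c) ∨ s = 3 ∧ m = n

theorem exists_direction_not_singular (hd : 0 < d) {n m : Fin d → ℤ} {s : ℕ}
    (hs : ¬ Singular n (s + 1) m) :
    ∃ c : Fin d × Bool, ∀ j, 1 ≤ j → j ≤ s → ¬ Singular n (s + 1 - j) (m + j • shift c) := by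
  by_cases hmn : m = n
  · subst hmn
    -- Starting above `n` itself, a path can meet the pattern only at a neighbour of `n` in layer 2
    -- after one step. It then starts in layer 3, where `n` is singular, contrary to `hs`.
    refine ⟨(⟨0, hd⟩, true), fun j hj1 hj2 hS => ?_⟩
    set c : Fin d × Bool := (⟨0, hd⟩, true)
    have hc : coord c (m + j • shift c) = coord c m + j := by
      rw [coord_add, coord_nsmul, coord_shift_self, mul_one]
    rcases hS with ⟨_, h⟩ | ⟨h, c', h'⟩ | ⟨_, h⟩
    · rw [h] at hc; omega
    · have h1 := coord_shift_le_one c c'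
      rw [h', coord_add] at hc
      have : s = 2 := by omega
      exact hs (Or.inr (Or.inr ⟨by omega, rfl⟩))
    · rw [h] at hc; omega
  · obtain ⟨i, hi⟩ := Function.ne_iff.1 hmn
    -- Walk away from `n` in a direction in which `m` is already ahead. After one step the lead is
    -- at least 2, whereas the pattern reaches only distance 1.
    obtain ⟨c, hc⟩ : ∃ c : Fin d × Bool, coord c n < coord c m := by
      rcases lt_or_gt_of_ne hi with h | h
      · exact ⟨(i, false), by simpa [coord] using h⟩
      · exact ⟨(i, true), by simpa [coord] using h⟩
    refine ⟨c, fun j hj1 hj2 hS => ?_⟩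
    have hc' : coord c (m + j • shift c) = coord c m + j := by
      rw [coord_add, coord_nsmul, coord_shift_self, mul_one]
    rcases hS with ⟨_, h⟩ | ⟨h, c', h'⟩ | ⟨_, h⟩
    · rw [h] at hc'; omega
    · have h1 := coord_shift_le_one c c'
      rw [h', coord_add] at hc'
      omega
    · rw [h] at hc'; omega

section Pattern

variable {k l : Fin d → ℕ} (n : Fin d → ℤ)

theorem varValuation_coef (c : Fin d × Bool) : varValuation (Var.xm1 n) (var (coef c)) = 1 :=
  varValuation_var_of_ne (coef_ne_xm1 c n).symm

theorem varValuation_xAux_eq_one_of_not_singular (hd : 0 < d) (hexp : ∀ c, expo k l c ≠ 0)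
    {s : ℕ} {m : Fin d → ℤ} (hs : ¬ Singular n (s + 1) m)
    (ih : ∀ s' < s, ∀ m', ¬ Singular n (s' + 1) m' →
      varValuation (Var.xm1 n) (xAux k l (s' + 1) m') = 1)
    (hint : varValuation (Var.xm1 n) (xAux k l (s + 1) m) ≤ 1) :
    varValuation (Var.xm1 n) (xAux k l (s + 1) m) = 1 := by
  rcases eq_or_ne s 0 with rfl | _
  · refine varValuation_var_of_ne fun h => hs (Or.inl ⟨rfl, (Var.xm1.inj h).symm⟩)
  obtain ⟨c, hc⟩ := exists_direction_not_singular hd hs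
  refine varValuation_xAux_eq_one_of_path hexp (fun c => (coef_ne_xm1 c n).symm) c
    (fun j hj1 hj2 => ?_) (fun h => ?_) hint
  · have h := hc j hj1 hj2
    rw [show s + 1 - j = (s - j) + 1 by omega] at h ⊢
    exact ih _ (by omega) _ h
  · exact hc s (by omega) le_rfl (Or.inl ⟨by omega, (Var.xm1.inj h).symm⟩)

theorem varValuation_xAux_one (m : Fin d → ℤ) (h : m ≠ n) :
    varValuation (Var.xm1 n) (xAux k l 1 m) = 1 :=
  varValuation_var_of_ne fun h' => h (Var.xm1.inj h').symm

theorem varValuation_xAux_zero (m : Fin d → ℤ) :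
    varValuation (Var.xm1 n) (xAux k l 0 m) = 1 :=
  varValuation_var_of_ne (by simp)

/-- The part of an iterate which is regular at the direction `c`. -/
def regularPart (k l : Fin d → ℕ) (c : Fin d × Bool) (s : ℕ) (m : Fin d → ℤ) : RatFun d :=
  ∑ c' ∈ Finset.univ.erase c,
    var (coef c') / xAux k l (s + 1) (m + shift c') ^ expo k l c' - xAux k l s m

theorem xAux_eq_add_regularPart (c : Fin d × Bool) (s : ℕ) (m : Fin d → ℤ) :
    xAux k l (s + 2) m = var (coef c) / xAux k l (s + 1) (m + shift c) ^ expo k l c +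
      regularPart k l c s m := by
  rw [xAux_add_two, regularPart, ← Finset.add_sum_erase _ _ (Finset.mem_univ c), add_sub_assoc]

theorem varValuation_regularPart_two (c : Fin d × Bool) :
    varValuation (Var.xm1 n) (regularPart k l c 0 (n - shift c)) ≤ 1 := by
  refine Valuation.map_sub_le _ (Valuation.map_sum_le _ fun c' hc' => ?_)
    (varValuation_xAux_zero n _).le
  have h : n - shift c + shift c' ≠ n := fun h => (Finset.mem_erase.1 hc').1
    (eq_of_shift_eq (by rw [sub_add_eq_add_sub, sub_eq_iff_eq_add] at h; exact add_left_cancel h))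
  rw [map_div₀, map_pow, zero_add, varValuation_xAux_one n _ h, varValuation_coef, one_pow, div_one]

/-- From `n - shift c` the zero at `n` is visible in the direction `c` only, and the other terms are
integral. The pole of that single term therefore survives with its exact order. -/
theorem varValuation_xAux_two_singular (hexp : ∀ c, expo k l c ≠ 0) (c : Fin d × Bool) :
    varValuation (Var.xm1 n) (xAux k l 2 (n - shift c)) =
      (varValuation (Var.xm1 n) (var (Var.xm1 n)) ^ expo k l c)⁻¹ := by
  have h1 : varValuation (Var.xm1 n) (var (coef c) /
      xAux k l (0 + 1) (n - shift c + shift c) ^ expo k l c) =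
      (varValuation (Var.xm1 n) (var (Var.xm1 n)) ^ expo k l c)⁻¹ := by
    rw [sub_add_cancel, map_div₀, map_pow, varValuation_coef, one_div, zero_add]
    rfl
  rw [xAux_eq_add_regularPart c 0, ← h1]
  refine Valuation.map_add_eq_of_lt_left _ ((varValuation_regularPart_two n c).trans_lt ?_)
  rw [h1]
  exact (one_lt_inv₀ (pow_pos (Valuation.pos_iff _ |>.2 (var_ne_zero _)) _)).2
    (pow_lt_one₀ zero_le (varValuation_var_self _) (hexp c))

theorem varValuation_xAux_two_le_one {m : Fin d → ℤ} (hm : ¬ Singular n 2 m) :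
    varValuation (Var.xm1 n) (xAux k l 2 m) ≤ 1 := by
  refine map_xAux_add_two_le_one _ (fun c => (varValuation_coef n c).le) (fun c => ?_)
    (varValuation_xAux_zero n _).le
  refine (varValuation_xAux_one n _ fun h => hm (Or.inr (Or.inl ⟨rfl, opp c, ?_⟩))).ge
  rw [← h, shift_opp, add_neg_cancel_right]

/-- Layer 2 has poles but no zeros, which is what makes layer 3 integral. -/
theorem one_le_varValuation_xAux_two (hd : 0 < d) (hexp : ∀ c, expo k l c ≠ 0) (m : Fin d → ℤ) :
    1 ≤ varValuation (Var.xm1 n) (xAux k l 2 m) := by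
  by_cases hm : Singular n 2 m
  · obtain ⟨c, rfl⟩ : ∃ c, m = n - shift c := by
      rcases hm with ⟨h, _⟩ | ⟨_, c, rfl⟩ | ⟨h, _⟩
      · omega
      · exact ⟨opp c, by rw [shift_opp, sub_neg_eq_add]⟩
      · omega
    rw [varValuation_xAux_two_singular n hexp]
    exact (one_le_inv₀ (pow_pos (Valuation.pos_iff _ |>.2 (var_ne_zero _)) _)).2
      (pow_le_one₀ zero_le (varValuation_var_self _).le)
  · refine (varValuation_xAux_eq_one_of_not_singular n hd hexp (s := 1) hm (fun s' hs' m' hm' => ?_)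
      (varValuation_xAux_two_le_one n hm)).ge
    obtain rfl : s' = 0 := by omega
    exact varValuation_xAux_one n m' fun h => hm' (Or.inl ⟨rfl, h⟩)

theorem varValuation_xAux_three_le_one (hd : 0 < d) (hexp : ∀ c, expo k l c ≠ 0)
    (m : Fin d → ℤ) : varValuation (Var.xm1 n) (xAux k l 3 m) ≤ 1 :=
  map_xAux_add_two_le_one _ (fun c => (varValuation_coef n c).le)
    (fun _ => one_le_varValuation_xAux_two n hd hexp _) (primeValuation_algebraMap_le_one _ _)

/-- The zero at time `1` recurs at time `3` up to a sign and to terms of high order. -/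
theorem varValuation_xAux_three_add (hexp : ∀ c, expo k l c ≠ 0)
    (hbig : ∀ c c', expo k l c' + 1 < expo k l c * expo k l (opp c)) (c' : Fin d × Bool) :
    varValuation (Var.xm1 n) (xAux k l 3 n + var (Var.xm1 n)) ≤
      varValuation (Var.xm1 n) (var (Var.xm1 n)) ^ (expo k l c' + 1) := by
  rw [show xAux k l 3 n = xAux k l (1 + 2) n from rfl, xAux_add_two]
  rw [show xAux k l 1 n = var (Var.xm1 n) from rfl, sub_add_cancel]
  refine Valuation.map_sum_le _ fun c _ => ?_
  have h := varValuation_xAux_two_singular n hexp (opp c)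
  rw [shift_opp, sub_neg_eq_add] at h
  -- The pole at `n + shift c` has the order belonging to `opp c` and is raised to the exponent of
  -- `c`. The term thus vanishes to the order of the product, which is some `k_i l_i`.
  rw [map_div₀, map_pow, varValuation_coef, h, inv_pow, one_div, inv_inv, ← pow_mul]
  refine pow_le_pow_of_le_one zero_le (varValuation_var_self _).le ?_
  rw [mul_comm]
  exact (hbig c c').le

theorem varValuation_xAux_four_le_one (hexp : ∀ c, expo k l c ≠ 0)
    (heven : ∀ c, Even (expo k l c))
    (hbig : ∀ c c', expo k l c' + 1 < expo k l c * expo k l (opp c))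
    (h3 : ∀ m, m ≠ n → varValuation (Var.xm1 n) (xAux k l 3 m) = 1) (m : Fin d → ℤ) :
    varValuation (Var.xm1 n) (xAux k l 4 m) ≤ 1 := by
  by_cases hm : Singular n 2 m
  · obtain ⟨c, rfl⟩ : ∃ c, m = n - shift c := by
      rcases hm with ⟨h, _⟩ | ⟨_, c, rfl⟩ | ⟨h, _⟩
      · omega
      · exact ⟨opp c, by rw [shift_opp, sub_neg_eq_add]⟩
      · omega
    have h2 : xAux k l 2 (n - shift c) = var (coef c) / var (Var.xm1 n) ^ expo k l c +
        regularPart k l c 0 (n - shift c) := by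
      rw [xAux_eq_add_regularPart c 0, sub_add_cancel]
      rfl
    -- Pair the polar term of layer 4 with the polar term of the subtracted layer 2. The first
    -- bracket is integral by the cancellation lemma with `h = xAux k l 3 n + var (Var.xm1 n)`, and
    -- everything else is regular at this site.
    have h4 : xAux k l 4 (n - shift c) =
        (var (coef c) / ((xAux k l 3 n + var (Var.xm1 n)) - var (Var.xm1 n)) ^ expo k l c -
          var (coef c) / var (Var.xm1 n) ^ expo k l c) +
        (∑ c' ∈ Finset.univ.erase c,
          var (coef c') / xAux k l 3 (n - shift c + shift c') ^ expo k l c' -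
          regularPart k l c 0 (n - shift c)) := by
      rw [xAux_eq_add_regularPart c 2, regularPart, h2, sub_add_cancel, add_sub_cancel_right]
      ring
    rw [h4]
    refine Valuation.map_add_le _ (Valuation.map_div_pow_sub_div_pow_le_one _ (varValuation_coef n c)
      (heven c) (var_ne_zero _) (varValuation_var_self _) (hexp c)
      (varValuation_xAux_three_add n hexp hbig c)) (Valuation.map_sub_le _
        (Valuation.map_sum_le _ fun c' hc' => ?_) (varValuation_regularPart_two n c))
    have h : n - shift c + shift c' ≠ n := fun h => (Finset.mem_erase.1 hc').1
      (eq_of_shift_eq (by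
        rw [sub_add_eq_add_sub, sub_eq_iff_eq_add] at h; exact add_left_cancel h))
    rw [map_div₀, map_pow, h3 _ h, varValuation_coef, one_pow, div_one]
  · refine map_xAux_add_two_le_one _ (fun c => (varValuation_coef n c).le) (fun c => ?_)
      (varValuation_xAux_two_le_one n hm)
    refine (h3 _ fun h => hm (Or.inr (Or.inl ⟨rfl, opp c, ?_⟩))).ge
    rw [← h, shift_opp, add_neg_cancel_right]

/-- Singularity confinement. -/
theorem varValuation_xAux_xm1 (hd : 0 < d) (hexp : ∀ c, expo k l c ≠ 0)
    (heven : ∀ c, Even (expo k l c))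
    (hbig : ∀ c c', expo k l c' + 1 < expo k l c * expo k l (opp c)) (s : ℕ) :
    ∀ m, ¬ Singular n (s + 1) m → varValuation (Var.xm1 n) (xAux k l (s + 1) m) = 1 := by
  induction s using Nat.strong_induction_on with
  | _ s ih =>
    intro m hm
    refine varValuation_xAux_eq_one_of_not_singular n hd hexp hm ih ?_
    match s, ih, hm with
    | 0, _, _ => exact primeValuation_algebraMap_le_one _ _
    | 1, _, hm => exact varValuation_xAux_two_le_one n hm
    | 2, _, _ => exact varValuation_xAux_three_le_one n hd hexp m
    | 3, ih, _ =>
      refine varValuation_xAux_four_le_one n hexp heven hbig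
        (fun m hm => ih 2 (by omega) m ?_) m
      rintro (⟨h, _⟩ | ⟨h, _⟩ | ⟨_, h⟩)
      · omega
      · omega
      · exact hm h
    | s + 4, ih, _ =>
      -- No site is singular after layer 3, so the preceding layer consists of units. The layer two
      -- below may still be layer 3, for which integrality is enough.
      refine map_xAux_add_two_le_one _ (fun c => (varValuation_coef n c).le)
        (fun c => (ih (s + 3) (by omega) _ (by simp [Singular])).ge) ?_
      match s, ih with
      | 0, _ => exact varValuation_xAux_three_le_one n hd hexp m
      | s + 1, ih => exact (ih (s + 3) (by omega) _ (by simp [Singular])).le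

end Pattern

open MvPolynomial

/-! ### The evolution as an endomorphism of the function field -/

section TimeStep

variable (d) in
/-- The monomials in the indeterminates `x_{-1,m}`. -/
def xm1Monomials : Submonoid (Poly d) := Submonoid.closure (Set.range fun m => X (Var.xm1 m))

theorem xm1Monomials_le : xm1Monomials d ≤ nonZeroDivisors (Poly d) :=
  Submonoid.closure_le.2 (by
    rintro _ ⟨m, rfl⟩
    exact mem_nonZeroDivisors_of_ne_zero (X_ne_zero _))

variable (d) in
/-- The polynomials with the indeterminates `x_{-1,m}` inverted. -/
abbrev Laurent : Type := Localization (xm1Monomials d)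

theorem X_xm1_mem (m : Fin d → ℤ) : (X (Var.xm1 m) : Poly d) ∈ xm1Monomials d :=
  Submonoid.subset_closure ⟨m, rfl⟩

/-- The inverse of the indeterminate `x_{-1,m}`. -/
def xm1Inv (m : Fin d → ℤ) : Laurent d :=
  IsLocalization.mk' (Laurent d) (1 : Poly d) (⟨X (Var.xm1 m), X_xm1_mem m⟩ : xm1Monomials d)

theorem xm1_mul_xm1Inv (m : Fin d → ℤ) :
    algebraMap (Poly d) (Laurent d) (X (Var.xm1 m)) * xm1Inv m = 1 := by
  rw [xm1Inv, mul_comm]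
  exact (IsLocalization.mk'_spec (Laurent d) 1 ⟨_, X_xm1_mem m⟩).trans (map_one _)

variable (k l : Fin d → ℕ)

/-- The reflection `x_{-2,m} ↦ x_{0,m}` on polynomials. -/
def reflectPoly : Poly d →+* Laurent d :=
  eval₂Hom ((algebraMap (Poly d) (Laurent d)).comp C) fun
    | Var.xm2 m => ∑ c, algebraMap (Poly d) (Laurent d) (X (coef c)) *
        xm1Inv (m + shift c) ^ expo k l c - algebraMap (Poly d) (Laurent d) (X (Var.xm2 m))
    | w => algebraMap (Poly d) (Laurent d) (X w)

theorem reflectPoly_X {w : Var d} (hw : ∀ m, w ≠ Var.xm2 m) :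
    reflectPoly k l (X w) = algebraMap (Poly d) (Laurent d) (X w) := by
  rw [reflectPoly, eval₂Hom_X']
  cases w with
  | xm2 m => exact absurd rfl (hw m)
  | _ => rfl

theorem reflectPoly_xm2 (m : Fin d → ℤ) :
    reflectPoly k l (X (Var.xm2 m)) = ∑ c, algebraMap (Poly d) (Laurent d) (X (coef c)) *
        xm1Inv (m + shift c) ^ expo k l c - algebraMap (Poly d) (Laurent d) (X (Var.xm2 m)) := by
  rw [reflectPoly, eval₂Hom_X']

theorem isUnit_reflectPoly (f : xm1Monomials d) : IsUnit (reflectPoly k l f) := by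
  have h : xm1Monomials d ≤ (IsUnit.submonoid (Laurent d)).comap (reflectPoly k l) :=
    Submonoid.closure_le.2 (by
      rintro _ ⟨m, rfl⟩
      change IsUnit (reflectPoly k l (X (Var.xm1 m)))
      rw [reflectPoly_X k l (by simp)]
      exact IsUnit.of_mul_eq_one _ (xm1_mul_xm1Inv m))
  exact h f.2

/-- The reflection `x_{-2,m} ↦ x_{0,m}`. -/
def reflect : Laurent d →+* Laurent d := IsLocalization.lift (isUnit_reflectPoly k l)

theorem reflect_algebraMap (f : Poly d) :
    reflect k l (algebraMap (Poly d) (Laurent d) f) = reflectPoly k l f :=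
  IsLocalization.lift_eq _ _

theorem reflect_xm1Inv (m : Fin d → ℤ) : reflect k l (xm1Inv m) = xm1Inv m := by
  have h := congrArg (reflect k l) (xm1_mul_xm1Inv m)
  rw [map_mul, map_one, reflect_algebraMap, reflectPoly_X k l (by simp)] at h
  rw [← mul_one (reflect k l _), ← xm1_mul_xm1Inv m, ← mul_assoc,
    mul_comm (reflect k l _), h, one_mul]

/-- The equation is symmetric in `x_{t+1}` and `x_{t-1}`: each is the same function of layer `t`
minus the other, and layer `t` is fixed. This is the reversibility of the evolution. -/
theorem reflect_reflect (z : Laurent d) : reflect k l (reflect k l z) = z := by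
  have h : (reflect k l).comp (reflect k l) = RingHom.id _ := by
    refine IsLocalization.ringHom_ext (xm1Monomials d) (MvPolynomial.ringHom_ext (fun q => ?_)
      fun w => ?_)
    · simp [reflect_algebraMap, reflectPoly, eval₂Hom_C]
    · simp only [RingHom.comp_apply, RingHom.id_apply, reflect_algebraMap]
      by_cases hw : ∃ m, w = Var.xm2 m
      · obtain ⟨m, rfl⟩ := hw
        rw [reflectPoly_xm2]
        simp only [map_sub, map_sum, map_mul, map_pow, reflect_algebraMap, reflect_xm1Inv,
          reflectPoly_X k l (coef_ne_xm2 _), reflectPoly_xm2]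
        exact sub_sub_cancel _ _
      · push Not at hw
        rw [reflectPoly_X k l hw, reflect_algebraMap, reflectPoly_X k l hw]
  exact DFunLike.congr_fun h z

variable (d) in
/-- The embedding of the Laurent polynomials into the rational functions. -/
def laurentToRatFun : Laurent d →+* RatFun d :=
  IsLocalization.lift (M := xm1Monomials d) (g := algebraMap (Poly d) (RatFun d))
    fun f => isUnit_iff_ne_zero.2
      (IsFractionRing.to_map_ne_zero_of_mem_nonZeroDivisors (xm1Monomials_le f.2))

theorem laurentToRatFun_algebraMap (f : Poly d) :
    laurentToRatFun d (algebraMap (Poly d) (Laurent d) f) = algebraMap (Poly d) (RatFun d) f :=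
  IsLocalization.lift_eq _ _

theorem laurentToRatFun_xm1Inv (m : Fin d → ℤ) :
    laurentToRatFun d (xm1Inv m) = (var (Var.xm1 m))⁻¹ := by
  have h := congrArg (laurentToRatFun d) (xm1_mul_xm1Inv m)
  rw [map_mul, map_one, laurentToRatFun_algebraMap] at h
  exact eq_inv_of_mul_eq_one_right h

theorem laurentToRatFun_injective : Function.Injective (laurentToRatFun d) := by
  rw [injective_iff_map_eq_zero]
  intro z hz
  obtain ⟨f, s, rfl⟩ := IsLocalization.exists_mk'_eq (xm1Monomials d) z
  have h := congrArg (laurentToRatFun d) (IsLocalization.mk'_spec (Laurent d) f s)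
  rw [map_mul, hz, zero_mul, laurentToRatFun_algebraMap] at h
  rw [(IsFractionRing.injective (Poly d) (RatFun d)) (h.symm.trans (map_zero _).symm),
    IsLocalization.mk'_zero]

/-- Interchange of the two layers of initial variables. -/
def swapLayers : Var d → Var d
  | Var.xm2 m => Var.xm1 m
  | Var.xm1 m => Var.xm2 m
  | Var.a i => Var.a i
  | Var.b i => Var.b i

theorem swapLayers_injective : Function.Injective (swapLayers (d := d)) :=
  Function.LeftInverse.injective (g := swapLayers) fun w => by cases w <;> rfl

/-- The time evolution of polynomials in the initial variables. -/
def stepPoly : Poly d →+* RatFun d :=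
  ((laurentToRatFun d).comp (reflectPoly k l)).comp (rename swapLayers : Poly d →ₐ[ℚ] Poly d)

/-- Injectivity is what allows the step to extend to fractions. It comes from the reflection being
an involution, which is available only after the `x_{-1,m}` have been inverted. -/
theorem stepPoly_injective : Function.Injective (stepPoly k l) := by
  have h : Function.Injective (reflectPoly k l) := by
    have h1 : ⇑(reflectPoly k l) = reflect k l ∘ algebraMap (Poly d) (Laurent d) :=
      funext fun f => (reflect_algebraMap k l f).symm
    rw [h1]
    exact (Function.LeftInverse.injective (reflect_reflect k l)).comp
      (IsLocalization.injective _ xm1Monomials_le)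
  exact (laurentToRatFun_injective.comp h).comp (rename_injective _ swapLayers_injective)

/-- The time evolution, as an endomorphism of the field of rational functions. -/
def stepHom : RatFun d →+* RatFun d := IsFractionRing.lift (stepPoly_injective k l)

theorem stepHom_var (w : Var d) : stepHom k l (var w) = stepPoly k l (X w) :=
  IsFractionRing.lift_algebraMap _ _

theorem stepHom_coef (c : Fin d × Bool) : stepHom k l (var (coef c)) = var (coef c) := by
  have h : swapLayers (coef c) = coef c := by rw [coef]; split_ifs <;> rfl
  rw [stepHom_var]
  simp only [stepPoly, RingHom.comp_apply, RingHom.coe_coe, rename_X, h]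
  rw [reflectPoly_X k l (coef_ne_xm2 c), laurentToRatFun_algebraMap, var]

theorem stepHom_xAux (s : ℕ) : ∀ m, stepHom k l (xAux k l s m) = xAux k l (s + 1) m := by
  induction s using Nat.strong_induction_on with
  | _ s ih =>
    intro m
    match s, ih with
    | 0, _ =>
      rw [xAux, stepHom_var]
      simp only [stepPoly, RingHom.comp_apply, RingHom.coe_coe, rename_X, swapLayers]
      rw [reflectPoly_X k l (by simp), laurentToRatFun_algebraMap]
      rfl
    | 1, _ =>
      rw [xAux, stepHom_var, xAux_add_two]
      simp only [stepPoly, RingHom.comp_apply, RingHom.coe_coe, rename_X, swapLayers]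
      rw [reflectPoly_xm2]
      simp only [map_sub, map_sum, map_mul, map_pow, laurentToRatFun_algebraMap,
        laurentToRatFun_xm1Inv, inv_pow, ← div_eq_mul_inv]
      rfl
    | s + 2, ih =>
      rw [xAux_add_two, xAux_add_two]
      simp only [map_sub, map_sum, map_div₀, map_pow, stepHom_coef]
      rw [ih s (by omega)]
      simp only [ih (s + 1) (by omega)]

/-- The time evolution by `t` steps. -/
def evolve : ℕ → RatFun d →+* RatFun d
  | 0 => RingHom.id _
  | t + 1 => (stepHom k l).comp (evolve t)

theorem evolve_coef (t : ℕ) (c : Fin d × Bool) :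
    evolve k l t (var (coef c)) = var (coef c) := by
  induction t with
  | zero => rfl
  | succ t ih => rw [evolve, RingHom.comp_apply, ih, stepHom_coef]

theorem evolve_xAux (t s : ℕ) (m : Fin d → ℤ) :
    evolve k l t (xAux k l s m) = xAux k l (s + t) m := by
  induction t with
  | zero => rfl
  | succ t ih => rw [evolve, RingHom.comp_apply, ih, stepHom_xAux, add_assoc]

end TimeStep

/-! ### Reduction of an arbitrary prime to an indeterminate -/

/-- The fractions of images of polynomials under `φ`, with units of the valuation `v` as
denominators. -/
def layerFractions {Γ₀ : Type*} [LinearOrderedCommGroupWithZero Γ₀]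
    (v : Valuation (RatFun d) Γ₀) (φ : RatFun d →+* RatFun d) : Subring (RatFun d) where
  carrier := {z | ∃ f g : Poly d, v (φ (algebraMap _ _ g)) = 1 ∧
    z * φ (algebraMap _ _ g) = φ (algebraMap _ _ f)}
  mul_mem' := by
    rintro y z ⟨f, g, hg, h⟩ ⟨f', g', hg', h'⟩
    refine ⟨f * f', g * g', by simp only [map_mul, hg, hg', one_mul], ?_⟩
    simp only [map_mul, ← h, ← h']
    ring
  one_mem' := ⟨1, 1, by simp, by simp⟩
  add_mem' := by
    rintro y z ⟨f, g, hg, h⟩ ⟨f', g', hg', h'⟩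
    refine ⟨f * g' + f' * g, g * g', by simp only [map_mul, hg, hg', one_mul], ?_⟩
    simp only [map_mul, map_add, ← h, ← h']
    ring
  zero_mem' := ⟨0, 1, by simp, by simp⟩
  neg_mem' := by
    rintro y ⟨f, g, hg, h⟩
    exact ⟨-f, g, hg, by simp only [map_neg, ← h]; ring⟩

section LayerFractions

variable {Γ₀ : Type*} [LinearOrderedCommGroupWithZero Γ₀] (v : Valuation (RatFun d) Γ₀)

theorem map_mem_layerFractions (φ : RatFun d →+* RatFun d) (f : Poly d) :
    φ (algebraMap _ _ f) ∈ layerFractions v φ := ⟨f, 1, by simp, by simp⟩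

theorem inv_mem_layerFractions {φ : RatFun d →+* RatFun d} {z : RatFun d}
    (hz : z ∈ layerFractions v φ) (hv : v z = 1) : z⁻¹ ∈ layerFractions v φ := by
  obtain ⟨f, g, hg, h⟩ := hz
  refine ⟨g, f, by rw [← h, map_mul, hv, hg, one_mul], ?_⟩
  have hz0 : z ≠ 0 := by rintro rfl; rw [map_zero] at hv; exact zero_ne_one hv
  rw [← h, inv_mul_cancel_left₀ hz0]

variable {k l : Fin d → ℕ}

/-- Backward evolution. -/
theorem xAux_mem_layerFractions {t : ℕ}
    (h : ∀ s, s ≠ 0 → s ≤ t → ∀ m, v (xAux k l s m) = 1) (j : ℕ) :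
    j ≤ t → (∀ m, xAux k l (t - j) m ∈ layerFractions v (evolve k l t)) ∧
      ∀ m, xAux k l (t - j + 1) m ∈ layerFractions v (evolve k l t) := by
  induction j with
  | zero =>
    refine fun _ => ⟨fun m => ?_, fun m => ?_⟩
    · have h1 := evolve_xAux k l t 0 m
      rw [zero_add] at h1
      rw [Nat.sub_zero, ← h1]
      exact map_mem_layerFractions v _ _
    · have h1 := evolve_xAux k l t 1 m
      rw [add_comm] at h1
      rw [Nat.sub_zero, ← h1]
      exact map_mem_layerFractions v _ _
  | succ j ih =>
    intro hj
    obtain ⟨h0, h1⟩ := ih (by omega)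
    obtain ⟨r, hr⟩ : ∃ r, t - j = r + 1 := ⟨t - (j + 1), by omega⟩
    rw [show t - (j + 1) = r by omega]
    rw [hr] at h0 h1
    refine ⟨fun m => ?_, h0⟩
    -- Solve the equation for the oldest layer. The only inverses needed are those of layer `r + 1`,
    -- which lies between 1 and `t` and so consists of units of `v`.
    have h2 : xAux k l r m = ∑ c, var (coef c) * (xAux k l (r + 1) (m + shift c))⁻¹ ^ expo k l c -
        xAux k l (r + 2) m := by
      rw [xAux_add_two]
      simp only [inv_pow, ← div_eq_mul_inv]
      ring
    rw [h2]
    refine Subring.sub_mem _ (Subring.sum_mem _ fun c _ => Subring.mul_mem _ ?_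
      (Subring.pow_mem _ (inv_mem_layerFractions v (h0 _) (h _ (by omega) (by omega) _)) _)) (h1 m)
    rw [← evolve_coef k l t c]
    exact map_mem_layerFractions v _ _

theorem exists_coef_eq (w : Var d) :
    (∃ m, w = Var.xm2 m) ∨ (∃ m, w = Var.xm1 m) ∨ ∃ c, w = coef c := by
  cases w with
  | xm2 m => exact Or.inl ⟨m, rfl⟩
  | xm1 m => exact Or.inr (Or.inl ⟨m, rfl⟩)
  | a i => exact Or.inr (Or.inr ⟨(i, true), rfl⟩)
  | b i => exact Or.inr (Or.inr ⟨(i, false), rfl⟩)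

theorem evolve_C (t : ℕ) (q : ℚ) :
    evolve k l t (algebraMap (Poly d) (RatFun d) (C q)) = algebraMap (Poly d) (RatFun d) (C q) :=
  DFunLike.congr_fun (Subsingleton.elim
    ((evolve k l t).comp ((algebraMap (Poly d) (RatFun d)).comp C))
    ((algebraMap (Poly d) (RatFun d)).comp C)) q

/-- After `t` backward steps the original initial variables are recovered from layers `t` and `t +
1`, with unit denominators. Any polynomial can therefore be compared with images under `evolve`. -/
theorem algebraMap_mem_layerFractions {t : ℕ}
    (h : ∀ s, s ≠ 0 → s ≤ t → ∀ m, v (xAux k l s m) = 1) (f : Poly d) :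
    algebraMap (Poly d) (RatFun d) f ∈ layerFractions v (evolve k l t) := by
  induction f using MvPolynomial.induction_on with
  | C q =>
    rw [← evolve_C (k := k) (l := l) t q]
    exact map_mem_layerFractions v _ _
  | add f g hf hg => rw [map_add]; exact Subring.add_mem _ hf hg
  | mul_X f w hf =>
    rw [map_mul]
    refine Subring.mul_mem _ hf ?_
    obtain ⟨h0, h1⟩ := xAux_mem_layerFractions v h t le_rfl
    rw [Nat.sub_self] at h0 h1
    rcases exists_coef_eq w with ⟨m, rfl⟩ | ⟨m, rfl⟩ | ⟨c, rfl⟩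
    · exact h0 m
    · exact h1 m
    · have h2 := map_mem_layerFractions v (evolve k l t) (X (coef c))
      rwa [← var, evolve_coef] at h2

end LayerFractions

/-- If the layers `1, …, t` are units at the prime `p` and `x` at layer `t + 1` and site `n` is not,
then the valuation at `p` is, up to the evolution by `t` steps, the one attached to the
indeterminate at `n`. -/
theorem primeValuation_evolve_eq_one {k l : Fin d → ℕ} {p : Poly d} (hp : Prime p) {t : ℕ}
    {n : Fin d → ℤ}
    (h : ∀ s, s ≠ 0 → s ≤ t → ∀ m, primeValuation (RatFun d) hp (xAux k l s m) = 1)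
    (hint : ∀ m, primeValuation (RatFun d) hp (xAux k l (t + 1) m) ≤ 1)
    (hn0 : xAux k l (t + 1) n ≠ 0)
    (hn : primeValuation (RatFun d) hp (xAux k l (t + 1) n) < 1) {z : RatFun d}
    (hz : varValuation (Var.xm1 n) z = 1) :
    primeValuation (RatFun d) hp (evolve k l t z) = 1 := by
  set v := primeValuation (RatFun d) hp
  set φ := evolve k l t with hφ
  have hXn : φ (algebraMap (Poly d) (RatFun d) (X (Var.xm1 n))) = xAux k l (t + 1) n := by
    rw [add_comm, ← evolve_xAux]; rfl
  have hle : ∀ f : Poly d, v (φ (algebraMap _ _ f)) ≤ 1 := by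
    intro f
    induction f using MvPolynomial.induction_on with
    | C q => rw [hφ, evolve_C]; exact primeValuation_algebraMap_le_one _ _
    | add f g hf hg => rw [map_add, map_add]; exact v.map_add_le hf hg
    | mul_X f w hf =>
      rw [map_mul, map_mul, map_mul]
      refine mul_le_one' hf ?_
      rcases exists_coef_eq w with ⟨m, rfl⟩ | ⟨m, rfl⟩ | ⟨c, rfl⟩
      · have h1 := evolve_xAux k l t 0 m
        rw [zero_add] at h1
        change v (φ (xAux k l 0 m)) ≤ 1
        rw [h1]
        rcases eq_or_ne t 0 with rfl | ht
        · exact primeValuation_algebraMap_le_one _ _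
        · exact (h t ht le_rfl m).le
      · have h1 := evolve_xAux k l t 1 m
        rw [add_comm] at h1
        change v (φ (xAux k l 1 m)) ≤ 1
        rw [h1]
        exact hint m
      · change v (φ (var (coef c))) ≤ 1
        rw [hφ, evolve_coef]
        exact primeValuation_algebraMap_le_one _ _
  have hdvd : ∀ f : Poly d, X (Var.xm1 n) ∣ f → v (φ (algebraMap _ _ f)) ≠ 1 := by
    rintro _ ⟨g, rfl⟩
    rw [map_mul, map_mul, map_mul, hXn]
    exact (mul_lt_one_of_lt_of_le hn (hle g)).ne
  -- The polynomials whose image is a non-unit form a prime ideal containing `x_{-1,n}`; the claim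
  -- is that this ideal contains nothing else.
  have key : ∀ f : Poly d, ¬ X (Var.xm1 n) ∣ f → v (φ (algebraMap _ _ f)) = 1 := by
    intro f hf
    refine le_antisymm (hle f) (not_lt.1 fun hlt => ?_)
    have hf0 : φ (algebraMap _ _ f) ≠ 0 := by
      rw [ne_eq, map_eq_zero, FaithfulSMul.algebraMap_eq_zero_iff]
      rintro rfl
      exact hf (dvd_zero _)
    obtain ⟨i, hi0, hi⟩ := exists_primeValuation_eq_pow hp hf0 hlt
    obtain ⟨j, hj0, hj⟩ := exists_primeValuation_eq_pow hp hn0 hn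
    -- With valuations `v p ^ i` and `v p ^ j` for `φ f` and the iterate at `n`, these crossed
    -- exponents make the quotient a unit at `p`.
    set P := φ (algebraMap _ _ f) ^ j / xAux k l (t + 1) n ^ i with hP
    have hP1 : v P = 1 := by
      rw [hP, map_div₀, map_pow, map_pow]
      rw [hi, hj, ← pow_mul, ← pow_mul, mul_comm, div_self]
      exact pow_ne_zero _ ((Valuation.ne_zero_iff _).2
        ((FaithfulSMul.algebraMap_eq_zero_iff (Poly d) (RatFun d)).not.2 hp.ne_zero))
    obtain ⟨F, G, hF, hG, hFG⟩ := exists_eq_div_of_primeValuation_eq_one hp hP1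
    obtain ⟨A, B, hB, hAB⟩ := algebraMap_mem_layerFractions v h F
    obtain ⟨A', B', hB', hAB'⟩ := algebraMap_mem_layerFractions v h G
    have hG1 := (primeValuation_algebraMap_eq_one_iff (K := RatFun d) hp).2 hG
    have hA' : v (φ (algebraMap _ _ A')) = 1 := by
      rw [← hAB', map_mul, hB', mul_one]; exact hG1
    have hG0 : algebraMap (Poly d) (RatFun d) G ≠ 0 := fun h0 => by
      rw [h0, map_zero] at hG1; exact zero_ne_one hG1
    -- Expressing `F` and `G` through layers `t` and `t + 1` turns `P = F / G` into an identity
    -- between images under the injective `φ`, hence between polynomials. Then `x_{-1,n}` must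
    -- divide `f`, `A'` or `B`, but the images of `A'` and `B` are units.
    have heq : f ^ j * (A' * B) = X (Var.xm1 n) ^ i * (A * B') := by
      apply IsFractionRing.injective (Poly d) (RatFun d)
      apply φ.injective
      simp only [map_mul, map_pow, hXn]
      rw [← hφ] at hAB hAB'
      rw [hP, div_eq_div_iff (pow_ne_zero _ hn0) hG0] at hFG
      linear_combination φ (algebraMap _ _ B) * φ (algebraMap _ _ B') * hFG -
        φ (algebraMap _ _ f) ^ j * φ (algebraMap _ _ B) * hAB' +
        xAux k l (t + 1) n ^ i * φ (algebraMap _ _ B') * hAB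
    have hX : Prime (X (Var.xm1 n) : Poly d) := X_prime
    have h1 : X (Var.xm1 n) ∣ f ^ j * (A' * B) := by
      rw [heq]; exact (dvd_pow_self _ hi0).mul_right _
    rcases hX.dvd_or_dvd h1 with h2 | h2
    · exact hf (hX.dvd_of_dvd_pow h2)
    · rcases hX.dvd_or_dvd h2 with h3 | h3
      · exact hdvd _ h3 hA'
      · exact hdvd _ h3 hB
  obtain ⟨f, g, hf, hg, rfl⟩ := exists_eq_div_of_primeValuation_eq_one _ hz
  rw [map_div₀, map_div₀, key f hf, key g hg, div_one]

/-! ### Distances between non-unit sites -/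

theorem sum_abs_shift (c : Fin d × Bool) : ∑ i, |shift c i| = 1 := by
  rcases c with ⟨i, _ | _⟩ <;> simp [shift, e, Pi.single_apply, apply_ite abs]

/-- The pattern is the ℓ¹ unit sphere around `(2, n)`, and the triangle inequality through this
centre yields the bound 2 for two of its sites. -/
theorem Singular.dist_le {n m : Fin d → ℤ} {s : ℕ} (h : Singular n s m) :
    |(s : ℤ) - 2| + ∑ i, |m i - n i| ≤ 1 := by
  rcases h with ⟨rfl, rfl⟩ | ⟨rfl, c, rfl⟩ | ⟨rfl, rfl⟩
  · simp
  · simp [sum_abs_shift]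
  · simp

theorem sum_abs_sub_le (m m' n : Fin d → ℤ) :
    ∑ i, |m i - m' i| ≤ ∑ i, |m i - n i| + ∑ i, |m' i - n i| := by
  rw [← Finset.sum_add_distrib]
  refine Finset.sum_le_sum fun i _ => ?_
  rw [abs_sub_comm (m' i)]
  exact abs_sub_le _ _ _

theorem primeValuation_eq_one_of_associated {p q : Poly d} (hp : Prime p) (hq : Prime q)
    (h : Associated p q) {z : RatFun d} (hz : primeValuation (RatFun d) hp z = 1) :
    primeValuation (RatFun d) hq z = 1 := by
  obtain ⟨f, g, hf, hg, rfl⟩ := exists_eq_div_of_primeValuation_eq_one hp hz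
  rw [h.dvd_iff_dvd_left] at hf hg
  rw [map_div₀, (primeValuation_algebraMap_eq_one_iff hq).2 hf,
    (primeValuation_algebraMap_eq_one_iff hq).2 hg, div_one]

variable {k l : Fin d → ℕ}

theorem associated_of_primeValuation_xAux_zero {p : Poly d} (hp : Prime p) {m : Fin d → ℤ}
    (h : primeValuation (RatFun d) hp (xAux k l 0 m) ≠ 1) :
    Associated (X (Var.xm2 m)) p := by
  rw [xAux, var, ne_eq, primeValuation_algebraMap_eq_one_iff, not_not] at h
  exact ((hp.dvd_prime_iff_associated X_prime).1 h).symm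

/-- The sites at which an iterate is not a unit at a given prime are close to each other. -/
theorem dist_le_of_primeValuation_ne_one (hd : 0 < d) (hexp : ∀ c, expo k l c ≠ 0)
    (heven : ∀ c, Even (expo k l c))
    (hbig : ∀ c c', expo k l c' + 1 < expo k l c * expo k l (opp c))
    {p : Poly d} (hp : Prime p) {s s' : ℕ} {m m' : Fin d → ℤ}
    (h : primeValuation (RatFun d) hp (xAux k l s m) ≠ 1)
    (h' : primeValuation (RatFun d) hp (xAux k l s' m') ≠ 1) :
    |(s : ℤ) - s'| + ∑ i, |m i - m' i| ≤ 2 := by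
  by_cases hex : ∃ t n, primeValuation (RatFun d) hp (xAux k l (t + 1) n) ≠ 1
  · classical
    -- Layer `t + 1` is the first one after layer 0 with a non-unit at `p`. Layer 0 is left out of
    -- the search because its non-units leave no trace later.
    obtain ⟨n, hn⟩ := Nat.find_spec hex
    have hmin := fun t => Nat.find_min (H := hex) (m := t)
    set t := Nat.find hex
    have hunit : ∀ s, s ≠ 0 → s ≤ t → ∀ m,
        primeValuation (RatFun d) hp (xAux k l s m) = 1 := by
      intro s hs0 hst m
      obtain ⟨r, rfl⟩ := Nat.exists_eq_succ_of_ne_zero hs0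
      by_contra hne
      exact hmin r (by omega) ⟨m, hne⟩
    have hint : ∀ m, primeValuation (RatFun d) hp (xAux k l (t + 1) m) ≤ 1 := by
      intro m
      obtain ht | ⟨r, ht⟩ : t = 0 ∨ ∃ r, t = r + 1 := by
        rcases t with _ | r
        · exact Or.inl rfl
        · exact Or.inr ⟨r, rfl⟩
      · rw [ht]
        exact primeValuation_algebraMap_le_one _ _
      · rw [ht]
        refine map_xAux_add_two_le_one _ (fun c => primeValuation_algebraMap_le_one _ _)
          (fun c => (hunit _ (by omega) (by omega) _).ge) ?_
        rcases eq_or_ne r 0 with rfl | hr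
        · exact primeValuation_algebraMap_le_one _ _
        · exact (hunit r hr (by omega) m).le
    have hsing : ∀ {s : ℕ} {m : Fin d → ℤ}, primeValuation (RatFun d) hp (xAux k l s m) ≠ 1 →
        ∃ r, s = r + t ∧ Singular n r m := by
      intro s m h
      -- A non-unit below layer `t` could only lie in layer 0. Then `p` would be associated to some
      -- `x_{-2,m}`, at which all later iterates are units, contrary to the choice of `n`.
      have hts : t ≤ s := by
        by_contra hlt
        obtain rfl : s = 0 := by
          by_contra hs0
          exact h (hunit s hs0 (by omega) m)
        exact hn (primeValuation_eq_one_of_associated X_prime hp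
          (associated_of_primeValuation_xAux_zero hp h) (varValuation_xAux_xm2 hd hexp m t n))
      obtain ⟨r, rfl⟩ := Nat.exists_eq_add_of_le' hts
      refine ⟨r, rfl, ?_⟩
      by_contra hns
      refine h ?_
      rw [← evolve_xAux]
      refine primeValuation_evolve_eq_one hp hunit hint (xAux_ne_zero hd hexp _ _)
        (lt_of_le_of_ne (hint n) hn) ?_
      rcases r with _ | r
      · exact varValuation_xAux_zero n m
      · exact varValuation_xAux_xm1 n hd hexp heven hbig r m hns
    obtain ⟨r, rfl, hr⟩ := hsing h
    obtain ⟨r', rfl, hr'⟩ := hsing h'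
    have h1 := hr.dist_le
    have h2 := hr'.dist_le
    have h3 := sum_abs_sub_le m m' n
    have h4 : |((r + t : ℕ) : ℤ) - (r' + t : ℕ)| ≤ |(r : ℤ) - 2| + |(r' : ℤ) - 2| := by
      rw [abs_sub_comm (r' : ℤ)]
      push_cast
      rw [add_sub_add_right_eq_sub]
      exact abs_sub_le _ _ _
    omega
  · push Not at hex
    obtain rfl : s = 0 := by
      by_contra hs
      obtain ⟨r, rfl⟩ := Nat.exists_eq_succ_of_ne_zero hs
      exact h (hex r m)
    obtain rfl : s' = 0 := by
      by_contra hs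
      obtain ⟨r, rfl⟩ := Nat.exists_eq_succ_of_ne_zero hs
      exact h' (hex r m')
    -- Both sites lie in layer 0, so `p` is associated to both variables and the sites coincide.
    have h1 := (associated_of_primeValuation_xAux_zero hp h).trans
      (associated_of_primeValuation_xAux_zero hp h').symm
    rw [Var.xm2.inj (X_dvd_X.1 h1.dvd)]
    simp

end LatticeKdV

end

/-! ### The main theorem -/

theorem mainTheorem2 (d : ℕ) (hd : 0 < d) (k l : Fin d → ℕ)
    (hk : ∀ i, 0 < k i ∧ Even (k i)) (hl : ∀ i, 0 < l i ∧ Even (l i))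
    (hkl : ∀ i j, max (l j) (k j) < l i * k i - 1) :
    (∀ t : ℤ, -2 ≤ t → ∀ n : Fin d → ℤ, LatticeKdV.x k l t n ≠ 0) ∧
    ∀ t t' : ℤ, -2 ≤ t → -2 ≤ t' → ∀ n n' : Fin d → ℤ,
      2 < |t - t'| + ∑ i, |n i - n' i| →
      LatticeKdV.RatCoprime (LatticeKdV.x k l t n) (LatticeKdV.x k l t' n') := by
  have hexp : ∀ c, LatticeKdV.expo k l c ≠ 0 := by
    rintro ⟨i, _ | _⟩
    · exact (hl i).1.ne'
    · exact (hk i).1.ne'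
  have heven : ∀ c, Even (LatticeKdV.expo k l c) := by
    rintro ⟨i, _ | _⟩
    · exact (hl i).2
    · exact (hk i).2
  have hbig : ∀ c c', LatticeKdV.expo k l c' + 1 <
      LatticeKdV.expo k l c * LatticeKdV.expo k l (LatticeKdV.opp c) := by
    rintro c ⟨j, b⟩
    -- Opposite directions at the same index carry the exponents `k_i` and `l_i`, so the product is
    -- the one bounded in `hkl`.
    have h1 : LatticeKdV.expo k l c * LatticeKdV.expo k l (LatticeKdV.opp c) =
        l c.1 * k c.1 := by
      rcases c with ⟨i, _ | _⟩
      · rfl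
      · exact mul_comm _ _
    have h2 : LatticeKdV.expo k l (j, b) ≤ max (l j) (k j) := by
      cases b
      · exact le_max_left _ _
      · exact le_max_right _ _
    have h3 := hkl c.1 j
    omega
  refine ⟨fun t _ n => LatticeKdV.xAux_ne_zero hd hexp _ _, fun t t' ht ht' n n' hdist => ?_⟩
  refine LatticeKdV.ratCoprime_of_forall_prime (LatticeKdV.xAux_ne_zero hd hexp _ _)
    fun p hp h => ?_
  by_contra h'
  have h1 := LatticeKdV.dist_le_of_primeValuation_ne_one hd hexp heven hbig hp h h'
  rw [Int.toNat_of_nonneg (by omega), Int.toNat_of_nonneg (by omega),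
    add_sub_add_right_eq_sub] at h1
  omega
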